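/- Let $\mathbb{F}_q$ be a finite field with $q$ odd, let $n\ge 1$, and let $\eta$ be the quadratic character of $\mathbb{F}_q$. For a polynomial $h$ in $n$ variables let $N(h)$ be its number of roots in $\mathbb{F}_q^n$, and for $1\le k\le n$ put $h_k(x_1,\dots,x_k)=h(x_1,\dots,x_k,0,\dots,0)$. If $h=\sum_{j=1}^m a_jX^{D_j}$ with all $a_j\neq 0$ and distinct exponent vectors $D_j\in\mathbb{Z}_{\ge0}^n$, its coefficient vector is $(a_1,\dots,a_m)$ and its augmented degree matrix $\tilde D_h$ is the matrix with columns $(1,D_j)^T$, $1\le j\le m$. Two polynomials $h,h'$ are $*$-equivalent if, for suitable orderings of their terms, they have the same coefficient vector and the systems $\tilde D_h v^T\equiv 0$ and $\tilde D_{h'}v^T\equiv 0 \pmod{q-1}$ have the same solutions $v$; they are totally $*$-equivalent if $h_k$ is $*$-equivalent to $h'_k$ for all $1\le k\le n$. Let $$f=\sum_{j=1}^n a_j\,x_1^{d_{1,j}}x_2^{d_{2,j}}\cdots x_j^{d_{j,j}}-b,\qquad a_1,\dots,a_n\in\mathbb{F}_q^*,\ b\in\mathbb{F}_q,\ d_{i,j}>0\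 \text{ for all } 1\le i\le j\le n,$$ be a fully triangular polynomial such that $a_1,\dots,a_n$ are all squares or all non-squares in $\mathbb{F}_q$; put $\varepsilon=1$ in the first case and $\varepsilon=-1$ in the second. Suppose that $f$ is totally $*$-equivalent to a quadratic diagonal polynomial $g=c_1x_1^2+\dots+c_nx_n^2-e$ with $c_1,\dots,c_n\in\mathbb{F}_q^*$ and $e\in\mathbb{F}_q$. Let $$\zeta_1=\bigl(q(-1)^{(q-1)/2}\bigr)^{1/2}-1,\qquad \zeta_2=-\bigl(q(-1)^{(q-1)/2}\bigr)^{1/2}-1,$$ where $(\cdot)^{1/2}$ is the principal complex square root, and for $i=1,2$ let $$S_i=\frac{\zeta_i^{n+1}-(q-1)\zeta_i^n-\zeta_i q^{n-1}}{\zeta_i-q}.$$ a) If $b\ne0$, then $$N(f)=q^{n-2}(q-1)-\frac1{2q}\,(S_1+S_2)+\frac{\varepsilon\,\eta(b)}{2\bigl(q(-1)^{(q-1)/2}\bigr)^{1/2}}\,(S_1-S_2).$$ b) If $b=0$, then $$N(f)=2q^{n-1}-q^{n-2}+\frac{q-1}{2q}\,(S_1+S_2).$$ -/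

import Mathlib

namespace FullyTriangular

/-- The number `N(f)` of roots of `f` over the whole affine space. -/
noncomputable def numRoots {F : Type*} [Field F] {n : ℕ} (f : MvPolynomial (Fin n) F) : ℕ :=
  Nat.card {x : Fin n → F // MvPolynomial.eval x f = 0}

/-- `f = ∑ j, a_j X ^ D_j` with nonzero coefficients `a_j` and pairwise distinct exponent
vectors `D_j`; that is, `a` and `D` list the terms of `f` (in some order). -/
def IsExpansion {F : Type*} [Field F] {n m : ℕ} (f : MvPolynomial (Fin n) F)
    (a : Fin m → F) (D : Fin m → (Fin n →₀ ℕ)) : Prop :=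
  (∀ j, a j ≠ 0) ∧ Function.Injective D ∧ f = ∑ j, MvPolynomial.monomial (D j) (a j)

/-- The augmented degree matrix: the `j`-th column is `(1, D_j)`. -/
def augDegreeMatrix {n m : ℕ} (D : Fin m → (Fin n →₀ ℕ)) :
    Matrix (Fin (n + 1)) (Fin m) ℕ :=
  Matrix.of (Fin.cons (fun _ => 1) (fun i j => D j i))

/-- `*`-equivalence: the same coefficient vector (for suitable listings of the terms), and the
same solutions `v` modulo `q - 1` of the homogeneous linear systems given by the two augmented
degree matrices. -/
def StarEquiv {F : Type*} [Field F] [Fintype F] {n : ℕ} (f g : MvPolynomial (Fin n) F) : Prop :=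
  ∃ (m : ℕ) (a : Fin m → F) (D E : Fin m → (Fin n →₀ ℕ)),
    IsExpansion f a D ∧ IsExpansion g a E ∧
    ∀ v : Fin m → ZMod (Fintype.card F - 1),
      Matrix.mulVec ((augDegreeMatrix D).map (Nat.cast : ℕ → ZMod (Fintype.card F - 1))) v = 0 ↔
      Matrix.mulVec ((augDegreeMatrix E).map (Nat.cast : ℕ → ZMod (Fintype.card F - 1))) v = 0

/-- `f_k (x_1, …, x_k) = f (x_1, …, x_k, 0, …, 0)`, a polynomial in `k` variables. -/
noncomputable def truncate {F : Type*} [Field F] {n : ℕ} (k : ℕ) (f : MvPolynomial (Fin n) F) :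
    MvPolynomial (Fin k) F :=
  MvPolynomial.aeval
    (fun i : Fin n => if h : (i : ℕ) < k then MvPolynomial.X ⟨(i : ℕ), h⟩ else 0) f

/-- Total `*`-equivalence: `f_k` is `*`-equivalent to `g_k` for all `1 ≤ k ≤ n`. -/
def TotallyStarEquiv {F : Type*} [Field F] [Fintype F] {n : ℕ}
    (f g : MvPolynomial (Fin n) F) : Prop :=
  ∀ k : ℕ, 1 ≤ k → k ≤ n → StarEquiv (truncate k f) (truncate k g)

/-- `∑ j, a_j x_1 ^ d_{1,j} ⋯ x_j ^ d_{j,j} - b`. Only the entries `d i j` with `i ≤ j` matter. -/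
noncomputable def triangularPoly {F : Type*} [Field F] {n : ℕ} (a : Fin n → F)
    (d : Fin n → Fin n → ℕ) (b : F) : MvPolynomial (Fin n) F :=
  ∑ j, MvPolynomial.C (a j) * ∏ i ∈ Finset.Iic j, MvPolynomial.X i ^ d i j - MvPolynomial.C b

/-- `f` is fully triangular with coefficients `a_1, …, a_n` (all nonzero) and constant term
`-b`: all exponents `d_{i,j}`, `i ≤ j`, are positive. -/
def IsFullyTriangular {F : Type*} [Field F] {n : ℕ} (f : MvPolynomial (Fin n) F)
    (a : Fin n → F) (b : F) : Prop :=
  (∀ j, a j ≠ 0) ∧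
    ∃ d : Fin n → Fin n → ℕ, (∀ i j, i ≤ j → 0 < d i j) ∧ f = triangularPoly a d b

/-- `g = c_1 x_1 ^ 2 + ⋯ + c_n x_n ^ 2 - e` with all `c_j` nonzero. -/
def IsQuadraticDiagonal {F : Type*} [Field F] {n : ℕ} (g : MvPolynomial (Fin n) F) : Prop :=
  ∃ (c : Fin n → F) (e : F), (∀ j, c j ≠ 0) ∧
    g = ∑ j, MvPolynomial.C (c j) * MvPolynomial.X j ^ 2 - MvPolynomial.C e

/-- The complex number `(q (-1) ^ ((q - 1) / 2)) ^ (1 / 2)` (principal square root; `q` odd). -/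
noncomputable def sqrtQStar (q : ℕ) : ℂ :=
  ((q : ℂ) * (-1) ^ ((q - 1) / 2)) ^ (1 / 2 : ℂ)

noncomputable def zeta₁ (q : ℕ) : ℂ := sqrtQStar q - 1

noncomputable def zeta₂ (q : ℕ) : ℂ := -sqrtQStar q - 1

/-- `(ζ ^ (n + 1) - (q - 1) ζ ^ n - ζ q ^ (n - 1)) / (ζ - q)`; used for `n ≥ 1`. -/
noncomputable def geomTerm (q n : ℕ) (ζ : ℂ) : ℂ :=
  (ζ ^ (n + 1) - ((q : ℂ) - 1) * ζ ^ n - ζ * (q : ℂ) ^ (n - 1)) / (ζ - (q : ℂ))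

end FullyTriangular

namespace FullyTriangular

/-! ### Torus counts depend only on the solution set of the augmented system. -/

section Duality

/-! Only roots with all coordinates nonzero (torus roots) need to be compared. Vanishing of `∑ a_j
X^{D_j}` at `x` is unaffected by a scalar `t`, so the torus count is determined by the image of `(t,
x) ↦ (t x^{D_j})_j`, a subgroup of `(Fˣ)^m`. A subgroup of a finite abelian group is recovered from
the characters trivial on it, and here these are exactly the solutions mod `q - 1` of the augmented
system (`torusRoots_sum_monomial_congr`).

For a quadratic diagonal polynomial that solution set is symmetric in the terms: `∑ v_j = 0` and `2
v_j = 0` for all `j`, with or without a constant term. Hence it does not matter how the terms of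
`f_k` and `g_k` are matched, and `f_k` has as many torus roots as `∑_{j ≤ k} a_j x_j^2 - b`, with
the coefficients of `f` itself (`torusRoots_triangularPoly`). That number comes from a recursion on
`k` with eigenvalues `ζ₁, ζ₂` and `q - 1` (`two_mul_card_mul_torus_diagonal`).

A zero coordinate `x_i` kills every term of `f` from the `i`-th on. Sorting points by their first
zero therefore gives `N(f) = T_n + ∑_{k<n} q^{n-1-k} T_k`, with `T_k` the torus count of `f_k`
(`numRoots_triangularPoly`). The resulting geometric sums are the `S_i` up to a summand `q^{n-1}`.
-/

theorem card_fiber_mul_card_range {G H : Type*} [Group G] [Fintype G] [Group H] [Fintype H]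
    [DecidableEq H] (φ : G →* H) {y : H} (hy : y ∈ φ.range) :
    Finset.card {x | φ x = y} * Nat.card φ.range = Nat.card G := by
  classical
  have h1 : Fintype.card G = ∑ z : φ.range, Finset.card {x | φ.rangeRestrict x = z} := by
    rw [← Finset.card_univ]
    exact Finset.card_eq_sum_card_fiberwise (f := φ.rangeRestrict) (fun _ _ => Finset.mem_coe.2 (Finset.mem_univ _))
  rw [Nat.card_eq_fintype_card, Nat.card_eq_fintype_card, h1]
  have h2 : ∀ z : φ.range, Finset.card {x | φ.rangeRestrict x = z} = Finset.card {x | φ x = y} := by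
    rintro ⟨z, hz⟩
    rw [← MonoidHom.card_fiber_eq_of_mem_range φ (x := z) (y := y) hz hy]
    congr 1
    ext x
    simp [Subtype.ext_iff]
  rw [Finset.sum_congr rfl fun z _ => h2 z]
  simp [mul_comm]

/-- Every nonempty fibre has `|G| / |range|` points, so equal ranges mean equal fibre sizes. -/
theorem sum_comp_eq_of_range_eq {G H : Type*} [Group G] [Fintype G] [Group H] [Fintype H]
    (φ ψ : G →* H) (h : φ.range = ψ.range) (w : H → ℕ) :
    ∑ x, w (φ x) = ∑ x, w (ψ x) := by
  classical
  have key : ∀ y, Finset.card {x | φ x = y} = Finset.card {x | ψ x = y} := by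
    intro y
    by_cases hy : y ∈ φ.range
    · have h1 := card_fiber_mul_card_range φ hy
      have h2 := card_fiber_mul_card_range ψ (h ▸ hy)
      rw [← h2, h] at h1
      exact Nat.eq_of_mul_eq_mul_right Nat.card_pos h1
    · have hy' : y ∉ ψ.range := h ▸ hy
      rw [Finset.filter_false_of_mem (fun x _ hx => hy ⟨x, hx⟩),
        Finset.filter_false_of_mem (fun x _ hx => hy' ⟨x, hx⟩)]
  have expand : ∀ χ : G →* H, ∑ x, w (χ x) = ∑ y, Finset.card {x | χ x = y} * w y := by
    intro χ
    rw [← Finset.sum_fiberwise Finset.univ χ]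
    refine Finset.sum_congr rfl fun y _ => ?_
    rw [Finset.sum_congr rfl (g := fun _ => w y), Finset.sum_const, smul_eq_mul]
    intro x hx
    rw [(Finset.mem_filter.1 hx).2]
  rw [expand, expand]
  simp only [key]

variable {F : Type*} [Field F] [Fintype F]

theorem hasEnoughRootsOfUnity_card_units [DecidableEq F] :
    HasEnoughRootsOfUnity F (Fintype.card Fˣ) where
  prim := by
    obtain ⟨g, hg⟩ := IsCyclic.exists_generator (α := Fˣ)
    refine ⟨g, ?_⟩
    rw [IsPrimitiveRoot.coe_units_iff, ← Nat.card_eq_fintype_card,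
      ← orderOf_eq_card_of_forall_mem_zpowers hg]
    exact IsPrimitiveRoot.orderOf g
  cyc := rootsOfUnity.isCyclic F _

/-- The solutions of the homogeneous system given by the augmented degree matrix. -/
def IsAugSolution {σ ι : Type*} [Fintype ι] (N : ℕ) (D : ι → σ →₀ ℕ) (v : ι → ZMod N) : Prop :=
  ∑ j, v j = 0 ∧ ∀ i, ∑ j, (D j i : ZMod N) * v j = 0

variable {σ ι : Type*} [Fintype σ] [Fintype ι]

/-- The homomorphism sending `(t, x)` to the vector of the `t * x ^ D_j`. -/
def scaledMonomials (F : Type*) [Field F] (D : ι → σ →₀ ℕ) : Fˣ × (σ → Fˣ) →* (ι → Fˣ) where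
  toFun p j := p.1 * ∏ i, p.2 i ^ D j i
  map_one' := by ext; simp
  map_mul' p r := by
    ext j
    simp [mul_pow, Finset.prod_mul_distrib]
    ring

omit [Fintype F] in
theorem prod_zpow_scaledMonomials (D : ι → σ →₀ ℕ) (m : ι → ℤ) (p : Fˣ × (σ → Fˣ)) :
    ∏ j, scaledMonomials F D p j ^ m j =
      p.1 ^ (∑ j, m j) * ∏ i, p.2 i ^ (∑ j, (D j i : ℤ) * m j) := by
  have hz : ∀ (u : Fˣ) (e : ι → ℤ), ∏ j, u ^ e j = u ^ ∑ j, e j := fun u e => by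
    have := map_sum (zmultiplesHom (Additive Fˣ) (Additive.ofMul u)) e Finset.univ
    exact this.symm
  simp only [scaledMonomials, MonoidHom.coe_mk, OneHom.coe_mk, mul_zpow, Finset.prod_mul_distrib,
    hz]
  congr 1
  simp only [← Finset.prod_zpow]
  rw [Finset.prod_comm]
  refine Finset.prod_congr rfl fun i _ => ?_
  rw [← hz]
  refine Finset.prod_congr rfl fun j _ => ?_
  rw [zpow_mul, zpow_natCast]

theorem forall_units_zpow_eq_one_iff (s : ℤ) :
    (∀ u : Fˣ, u ^ s = 1) ↔ (s : ZMod (Fintype.card F - 1)) = 0 := by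
  classical
  rw [← Fintype.card_units, ← Group.exponent_dvd_iff_forall_zpow_eq_one, IsCyclic.exponent_eq_card,
    Nat.card_eq_fintype_card, CharP.intCast_eq_zero_iff (ZMod (Fintype.card Fˣ)) (Fintype.card Fˣ)]

/-- The row of ones records the exponent of `t`, the row `i` that of `x_i`. Since `Fˣ` is cyclic of
order `q - 1`, an exponent acts trivially iff it vanishes mod `q - 1`. -/
theorem isAugSolution_iff_forall_prod_eq_one (D : ι → σ →₀ ℕ) (m : ι → ℤ) :
    IsAugSolution (Fintype.card F - 1) D (fun j => (m j : ZMod (Fintype.card F - 1))) ↔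
      ∀ p, ∏ j, scaledMonomials F D p j ^ m j = 1 := by
  classical
  simp only [prod_zpow_scaledMonomials, IsAugSolution]
  have c1 : ∑ j, (m j : ZMod (Fintype.card F - 1)) = ((∑ j, m j : ℤ) : ZMod _) := by push_cast; rfl
  have c2 : ∀ i, ∑ j, (D j i : ZMod (Fintype.card F - 1)) * (m j : ZMod (Fintype.card F - 1)) =
      ((∑ j, (D j i : ℤ) * m j : ℤ) : ZMod _) := fun i => by push_cast; rfl
  simp only [c1, c2, ← forall_units_zpow_eq_one_iff]
  constructor
  · rintro ⟨h1, h2⟩ p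
    simp [h1, h2]
  · refine fun h => ⟨fun u => by simpa using h (u, 1), fun i u => ?_⟩
    have := h (1, Pi.mulSingle i u)
    rw [Finset.prod_eq_single i] at this
    · simpa using this
    · intro l _ hl
      simp [Pi.mulSingle_eq_of_ne hl]
    · simp

theorem exists_zpow_of_monoidHom [DecidableEq ι] (χ : (ι → Fˣ) →* Fˣ) :
    ∃ m : ι → ℤ, ∀ y, χ y = ∏ j, y j ^ m j := by
  choose m hm using fun j => MonoidHom.map_cyclic (χ.comp (MonoidHom.mulSingle (fun _ : ι => Fˣ) j))
  refine ⟨m, fun y => ?_⟩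
  conv_lhs => rw [← Finset.univ_prod_mulSingle y, map_prod]
  exact Finset.prod_congr rfl fun j _ => hm j (y j)

/-- By duality, a point lies in a subgroup once every character trivial on the subgroup is trivial
at the point. Characters may be taken with values in `Fˣ`, which contains all roots of unity needed,
and each is `y ↦ ∏ y_j ^ m_j`. -/
theorem range_scaledMonomials_le (D E : ι → σ →₀ ℕ)
    (h : ∀ v : ι → ZMod (Fintype.card F - 1), IsAugSolution _ E v → IsAugSolution _ D v) :
    (scaledMonomials F D).range ≤ (scaledMonomials F E).range := by
  classical
  have := hasEnoughRootsOfUnity_card_units (F := F)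
  have : HasEnoughRootsOfUnity F (Monoid.exponent (ι → Fˣ)) :=
    HasEnoughRootsOfUnity.of_dvd F (n := Fintype.card Fˣ)
      (Monoid.exponent_dvd_of_forall_pow_eq_one fun y => by ext; simp)
  rintro _ ⟨p, rfl⟩
  rw [← CommGroup.forall_monoidHom_apply_eq_one_iff F]
  intro χ hχ
  obtain ⟨m, hm⟩ := exists_zpow_of_monoidHom χ
  rw [hm]
  refine (isAugSolution_iff_forall_prod_eq_one D m).1 (h _ ?_) p
  exact (isAugSolution_iff_forall_prod_eq_one E m).2 fun r => by rw [← hm, hχ _ ⟨r, rfl⟩]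

/-- The number of roots of `f` with all coordinates nonzero. -/
noncomputable def torusRoots (f : MvPolynomial σ F) : ℕ := by
  classical exact ∑ x : σ → Fˣ, if MvPolynomial.eval (fun i => (x i : F)) f = 0 then 1 else 0

theorem torusRoots_sum_monomial_congr (a : ι → F) (D E : ι → σ →₀ ℕ)
    (h : ∀ v : ι → ZMod (Fintype.card F - 1), IsAugSolution _ D v ↔ IsAugSolution _ E v) :
    torusRoots (∑ j, MvPolynomial.monomial (D j) (a j)) =
      torusRoots (∑ j, MvPolynomial.monomial (E j) (a j)) := by
  classical
  have hr : (scaledMonomials F D).range = (scaledMonomials F E).range :=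
    le_antisymm (range_scaledMonomials_le D E fun v => (h v).2)
      (range_scaledMonomials_le E D fun v => (h v).1)
  have hs := sum_comp_eq_of_range_eq _ _ hr
    (fun y => if ∑ j, a j * (y j : F) = 0 then 1 else 0)
  -- The parameter `t` factors out of the linear form, so each torus root is counted `|Fˣ|` times.
  have key : ∀ D : ι → σ →₀ ℕ, ∑ p, (if ∑ j, a j * (scaledMonomials F D p j : F) = 0 then 1 else 0)
      = Fintype.card Fˣ * torusRoots (∑ j, MvPolynomial.monomial (D j) (a j)) := by
    intro D
    rw [Fintype.sum_prod_type, torusRoots, ← Finset.card_univ, ← smul_eq_mul, ← Finset.sum_const]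
    refine Finset.sum_congr rfl fun t _ => Finset.sum_congr rfl fun x _ => ?_
    have : ∑ j, a j * (scaledMonomials F D (t, x) j : F) =
        t * MvPolynomial.eval (fun i => (x i : F)) (∑ j, MvPolynomial.monomial (D j) (a j)) := by
      rw [map_sum, Finset.mul_sum]
      refine Finset.sum_congr rfl fun j _ => ?_
      rw [MvPolynomial.eval_monomial, Finsupp.prod_fintype _ _ (by simp)]
      simp [scaledMonomials]
      ring
    rw [this]
    simp
  rw [key, key] at hs
  exact Nat.eq_of_mul_eq_mul_left Fintype.card_pos hs

end Duality
end FullyTriangular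

namespace FullyTriangular

/-! ### Listings of terms and diagonal exponent systems. -/

section Expansions

variable {F : Type*} [Field F] {σ ι κ : Type*} [Fintype ι] [Fintype κ]

theorem coeff_sum_monomial {a : ι → F} {D : ι → σ →₀ ℕ} (hD : Function.Injective D) (j : ι) :
    MvPolynomial.coeff (D j) (∑ i, MvPolynomial.monomial (D i) (a i)) = a j := by
  classical
  simp [MvPolynomial.coeff_sum, MvPolynomial.coeff_monomial, hD.eq_iff]

theorem exists_eq_of_coeff_sum_monomial_ne_zero {a : ι → F} {D : ι → σ →₀ ℕ} {d : σ →₀ ℕ}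
    (h : MvPolynomial.coeff d (∑ i, MvPolynomial.monomial (D i) (a i)) ≠ 0) : ∃ j, D j = d := by
  classical
  rw [MvPolynomial.coeff_sum] at h
  obtain ⟨j, -, hj⟩ := Finset.exists_ne_zero_of_sum_ne_zero h
  rw [MvPolynomial.coeff_monomial] at hj
  exact ⟨j, by_contra fun hne => hj (if_neg hne)⟩

/-- Two listings of the terms of a polynomial differ by a reindexing. -/
theorem exists_equiv_of_sum_monomial_eq {a : ι → F} {D : ι → σ →₀ ℕ} {a' : κ → F}
    {D' : κ → σ →₀ ℕ} (ha : ∀ j, a j ≠ 0) (hD : Function.Injective D) (ha' : ∀ j, a' j ≠ 0)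
    (hD' : Function.Injective D')
    (h : ∑ i, MvPolynomial.monomial (D i) (a i) = ∑ i, MvPolynomial.monomial (D' i) (a' i)) :
    ∃ e : ι ≃ κ, ∀ j, D' (e j) = D j ∧ a' (e j) = a j := by
  have h1 : ∀ j, ∃ i, D' i = D j := fun j => exists_eq_of_coeff_sum_monomial_ne_zero (a := a') <| by
    rw [← h, coeff_sum_monomial hD]; exact ha j
  have h2 : ∀ j, ∃ i, D i = D' j := fun j => exists_eq_of_coeff_sum_monomial_ne_zero (a := a) <| by
    rw [h, coeff_sum_monomial hD']; exact ha' j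
  choose u hu using h1
  choose v hv using h2
  refine ⟨⟨u, v, fun j => hD (by rw [hv, hu]), fun j => hD' (by rw [hu, hv])⟩, fun j => ⟨hu j, ?_⟩⟩
  change a' (u j) = a j
  rw [← coeff_sum_monomial (a := a') hD' (u j), ← h, hu, coeff_sum_monomial hD]

end Expansions

/-- The exponent vectors of a quadratic diagonal polynomial, in some order. -/
structure IsDiagonalListing {σ ι : Type*} (E : ι → σ →₀ ℕ) : Prop where
  injective : Function.Injective E
  eq_zero_or : ∀ j, E j = 0 ∨ ∃ i, E j = Finsupp.single i 2
  exists_eq : ∀ i, ∃ j, E j = Finsupp.single i 2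

theorem IsDiagonalListing.comp_equiv {σ ι κ : Type*} {E : ι → σ →₀ ℕ} (hE : IsDiagonalListing E)
    (e : κ ≃ ι) : IsDiagonalListing (E ∘ e) where
  injective := hE.injective.comp e.injective
  eq_zero_or j := hE.eq_zero_or (e j)
  exists_eq i := by
    obtain ⟨j, hj⟩ := hE.exists_eq i
    exact ⟨e.symm j, by simpa using hj⟩

/-- The right-hand side is invariant under permuting the terms and does not see whether one of them
is constant; this is what makes the choice of listing irrelevant. -/
theorem IsDiagonalListing.isAugSolution_iff {σ ι : Type*} [Fintype ι] {E : ι → σ →₀ ℕ}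
    (hE : IsDiagonalListing E) {N : ℕ} (v : ι → ZMod N) :
    IsAugSolution N E v ↔ ∑ j, v j = 0 ∧ ∀ j, 2 * v j = 0 := by
  classical
  have hrow : ∀ i j, E j = Finsupp.single i 2 → ∑ l, (E l i : ZMod N) * v l = 2 * v j := by
    intro i j hj
    rw [Finset.sum_eq_single j]
    · simp [hj]
    · intro l _ hl
      rcases hE.eq_zero_or l with h | ⟨i', h⟩
      · simp [h]
      · have : i' ≠ i := by
          rintro rfl
          exact hl (hE.injective (h.trans hj.symm))
        simp [h, this]
    · simp
  refine and_congr_right fun hsum => ⟨fun h => ?_, fun h i => ?_⟩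
  · have h2 : ∀ j, E j ≠ 0 → 2 * v j = 0 := fun j hj => by
      obtain ⟨i, hi⟩ := (hE.eq_zero_or j).resolve_left hj
      rw [← hrow i j hi, h]
    intro j
    by_cases hj : E j = 0
    -- No variable row constrains the constant term; its condition follows by doubling the row of
    -- ones.
    · have hs : ∑ l, 2 * v l = 2 * v j := by
        refine Finset.sum_eq_single j (fun l _ hl => h2 l fun h0 => hl (hE.injective ?_)) (by simp)
        rw [h0, hj]
      rw [← hs, ← Finset.mul_sum, hsum, mul_zero]
    · exact h2 j hj
  · obtain ⟨j, hj⟩ := hE.exists_eq i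
    rw [hrow i j hj, h]

theorem mulVec_augDegreeMatrix_eq_zero_iff {k m N : ℕ} (D : Fin m → Fin k →₀ ℕ)
    (v : Fin m → ZMod N) :
    Matrix.mulVec ((augDegreeMatrix D).map (Nat.cast : ℕ → ZMod N)) v = 0 ↔
      IsAugSolution N D v := by
  simp [funext_iff, Fin.forall_fin_succ, Matrix.mulVec, dotProduct, augDegreeMatrix, IsAugSolution]

/-! ### From a triangular polynomial to the diagonal one with the same coefficients. -/

section Diagonal

variable {F : Type*} [Field F]

theorem coeff_quadraticDiagonal {k : ℕ} (c : Fin k → F) (e : F) (d : Fin k →₀ ℕ) :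
    MvPolynomial.coeff d (∑ j, MvPolynomial.C (c j) * MvPolynomial.X j ^ 2 - MvPolynomial.C e) =
      ∑ j, (if Finsupp.single j 2 = d then c j else 0) - if 0 = d then e else 0 := by
  classical
  rw [MvPolynomial.coeff_sub, MvPolynomial.coeff_sum, MvPolynomial.coeff_C]
  congr 1
  refine Finset.sum_congr rfl fun j _ => ?_
  rw [MvPolynomial.coeff_C_mul, MvPolynomial.coeff_X_pow]
  simp

theorem isDiagonalListing_of_isExpansion {k m : ℕ} {g : MvPolynomial (Fin k) F}
    (hg : IsQuadraticDiagonal g) {a : Fin m → F} {E : Fin m → Fin k →₀ ℕ}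
    (h : IsExpansion g a E) : IsDiagonalListing E := by
  classical
  obtain ⟨c, e, hc, rfl⟩ := hg
  obtain ⟨ha, hE, hsum⟩ := h
  have hinj : Function.Injective fun i : Fin k => Finsupp.single i 2 := fun i j hij =>
    Finsupp.single_left_injective two_ne_zero hij
  refine ⟨hE, fun j => ?_, fun i => ?_⟩
  · by_contra! hj
    apply ha j
    rw [← coeff_sum_monomial (a := a) hE j, ← hsum, coeff_quadraticDiagonal, if_neg (Ne.symm hj.1)]
    simp [fun i => Ne.symm (hj.2 i)]
  · refine exists_eq_of_coeff_sum_monomial_ne_zero (a := a) ?_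
    rw [← hsum, coeff_quadraticDiagonal, if_neg (Finsupp.single_ne_zero.2 two_ne_zero).symm]
    rw [sub_zero, Finset.sum_eq_single i (fun l _ hl => if_neg fun h => hl (hinj h)) (by simp), if_pos rfl]
    exact hc i

variable [Fintype F]

/-- The equivalence may pair the constant term of `f` with a square in `g`. Any diagonal listing has
the same solution set, so the one supplied by `g` can be exchanged for `E`. -/
theorem torusRoots_eq_of_starEquiv {k : ℕ} {f g : MvPolynomial (Fin k) F} (hfg : StarEquiv f g)
    (hg : IsQuadraticDiagonal g) {ι : Type*} [Fintype ι] {a : ι → F} {D E : ι → Fin k →₀ ℕ}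
    (ha : ∀ j, a j ≠ 0) (hD : Function.Injective D)
    (hf : f = ∑ j, MvPolynomial.monomial (D j) (a j)) (hE : IsDiagonalListing E) :
    torusRoots f = torusRoots (∑ j, MvPolynomial.monomial (E j) (a j)) := by
  obtain ⟨m, a', D', E', ⟨ha', hD', hf'⟩, hgE, hsol⟩ := hfg
  simp only [mulVec_augDegreeMatrix_eq_zero_iff] at hsol
  have hE' := isDiagonalListing_of_isExpansion hg hgE
  obtain ⟨e, he⟩ := exists_equiv_of_sum_monomial_eq ha hD ha' hD' (hf.symm.trans hf')
  have hsum : ∑ j, MvPolynomial.monomial (E j) (a j) =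
      ∑ j, MvPolynomial.monomial ((E ∘ e.symm) j) (a' j) := by
    rw [← e.sum_comp]
    simp [he]
  rw [hf', hsum]
  refine torusRoots_sum_monomial_congr a' D' _ fun v => ?_
  rw [hsol, hE'.isAugSolution_iff, (hE.comp_equiv e.symm).isAugSolution_iff]

/-- The exponent vector of the `j`-th term of a triangular polynomial. -/
noncomputable def triangularExponent {k : ℕ} (d : Fin k → Fin k → ℕ) (j : Fin k) : Fin k →₀ ℕ :=
  Finsupp.equivFunOnFinite.symm fun i => if i ≤ j then d i j else 0

omit [Fintype F] in
theorem triangularPoly_eq {k : ℕ} (a : Fin k → F) (d : Fin k → Fin k → ℕ) (b : F) :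
    triangularPoly a d b =
      ∑ j, MvPolynomial.monomial (triangularExponent d j) (a j) + MvPolynomial.monomial 0 (-b) := by
  rw [triangularPoly, sub_eq_add_neg, ← map_neg]
  congr 1
  refine Finset.sum_congr rfl fun j _ => ?_
  rw [MvPolynomial.monomial_eq, Finsupp.prod_fintype _ _ (by simp)]
  congr 1
  simp only [triangularExponent, Finsupp.equivFunOnFinite_symm_apply_apply, pow_ite, pow_zero]
  rw [Finset.prod_ite, Finset.prod_const_one, mul_one]
  refine Finset.prod_congr ?_ fun _ _ => rfl
  ext; simp

theorem triangularExponent_injective {k : ℕ} {d : Fin k → Fin k → ℕ} (hd : ∀ i j, i ≤ j → 0 < d i j) :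
    Function.Injective (triangularExponent d) := by
  intro i j h
  have hle : ∀ i j, triangularExponent d i = triangularExponent d j → i ≤ j := by
    intro i j h
    by_contra hij
    have := DFunLike.congr_fun h i
    simp only [triangularExponent, Finsupp.equivFunOnFinite_symm_apply_apply, le_refl, if_true,
      if_neg hij] at this
    exact (hd i i le_rfl).ne' this
  exact le_antisymm (hle i j h) (hle j i h.symm)

theorem triangularExponent_ne_zero {k : ℕ} {d : Fin k → Fin k → ℕ} (hd : ∀ i j, i ≤ j → 0 < d i j)
    (j : Fin k) : triangularExponent d j ≠ 0 := by
  intro h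
  have := DFunLike.congr_fun h j
  simp only [triangularExponent, Finsupp.equivFunOnFinite_symm_apply_apply, le_refl, if_true] at this
  exact (hd j j le_rfl).ne' this

theorem torusRoots_triangularPoly {k : ℕ} {a : Fin k → F} {d : Fin k → Fin k → ℕ} {b : F}
    (ha : ∀ j, a j ≠ 0) (hd : ∀ i j, i ≤ j → 0 < d i j) {g : MvPolynomial (Fin k) F}
    (hg : IsQuadraticDiagonal g) (h : StarEquiv (triangularPoly a d b) g) :
    torusRoots (triangularPoly a d b) =
      torusRoots (∑ j, MvPolynomial.C (a j) * MvPolynomial.X j ^ 2 - MvPolynomial.C b) := by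
  have hinj : Function.Injective fun i : Fin k => Finsupp.single i 2 := fun i j hij =>
    Finsupp.single_left_injective two_ne_zero hij
  have hdiag : ∑ j, MvPolynomial.C (a j) * MvPolynomial.X j ^ 2 - MvPolynomial.C b =
      ∑ j, MvPolynomial.monomial (Finsupp.single j 2) (a j) + MvPolynomial.monomial 0 (-b) := by
    rw [sub_eq_add_neg, ← map_neg]
    simp [MvPolynomial.C_mul_X_pow_eq_monomial]
  rw [hdiag]
  by_cases hb : b = 0
  · subst hb
    rw [torusRoots_eq_of_starEquiv h hg ha (triangularExponent_injective hd)
      (by simp [triangularPoly_eq]) ⟨hinj, fun j => Or.inr ⟨j, rfl⟩, fun i => ⟨i, rfl⟩⟩]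
    simp
  -- For `b ≠ 0` there is one more term; `none` indexes the constant `-b`.
  · rw [torusRoots_eq_of_starEquiv h hg (ι := Option (Fin k)) (a := fun o => o.elim (-b) a)
      (D := fun o => o.elim 0 (triangularExponent d))
      (E := fun o => o.elim 0 fun i => Finsupp.single i 2) ?_ ?_ ?_ ?_]
    · rw [Fintype.sum_option, add_comm]; rfl
    · rintro (_ | j)
      · simpa using hb
      · exact ha j
    · rintro (_ | i) (_ | j) hij
      · rfl
      · exact absurd hij.symm (triangularExponent_ne_zero hd j)
      · exact absurd hij (triangularExponent_ne_zero hd i)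
      · exact congrArg some (triangularExponent_injective hd hij)
    · rw [triangularPoly_eq, Fintype.sum_option, add_comm]; rfl
    · refine ⟨?_, ?_, fun i => ⟨some i, rfl⟩⟩
      · rintro (_ | i) (_ | j) hij
        · rfl
        · simp [eq_comm (a := (0 : Fin k →₀ ℕ))] at hij
        · simp at hij
        · exact congrArg some (hinj hij)
      · rintro (_ | j)
        · exact Or.inl rfl
        · exact Or.inr ⟨j, rfl⟩

end Diagonal

/-! ### Truncation of triangular and diagonal polynomials. -/

section Truncation

variable {F : Type*} [Field F]

/-- Each term beyond the `k`-th contains its own variable to a positive power, hence dies under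
truncation. -/
theorem truncate_triangularPoly {k r : ℕ} (a : Fin (k + r) → F) {d : Fin (k + r) → Fin (k + r) → ℕ}
    (hd : ∀ i j, i ≤ j → 0 < d i j) (b : F) :
    truncate k (triangularPoly a d b) =
      triangularPoly (fun j => a (Fin.castAdd r j))
        (fun i j => d (Fin.castAdd r i) (Fin.castAdd r j)) b := by
  have hz : ∀ j : Fin r, truncate k (MvPolynomial.C (a (Fin.natAdd k j)) *
      ∏ i ∈ Finset.Iic (Fin.natAdd k j), MvPolynomial.X i ^ d i (Fin.natAdd k j)) = 0 := by
    intro j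
    rw [truncate, map_mul, map_prod, Finset.prod_eq_zero (i := Fin.natAdd k j) (by simp), mul_zero]
    simp [(hd (Fin.natAdd k j) (Fin.natAdd k j) le_rfl).ne']
  have hIic : ∀ j : Fin k,
      Finset.Iic (Fin.castAdd r j) = (Finset.Iic j).map (Fin.castAddEmb r) := by
    intro j
    ext i
    simp only [Finset.mem_Iic, Finset.mem_map]
    constructor
    · intro h
      exact ⟨⟨i, lt_of_le_of_lt h j.2⟩, h, rfl⟩
    · rintro ⟨i, h, rfl⟩
      exact h
  simp only [truncate] at hz
  simp only [truncate, triangularPoly, map_sub, Fin.sum_univ_add, map_add]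
  rw [map_sum, map_sum, Finset.sum_eq_zero (fun j _ => hz j), add_zero]
  congr 1
  · refine Finset.sum_congr rfl fun j _ => ?_
    rw [map_mul, map_prod, MvPolynomial.aeval_C, MvPolynomial.algebraMap_eq, hIic, Finset.prod_map]
    simp
  · simp

theorem truncate_isQuadraticDiagonal {k r : ℕ} {g : MvPolynomial (Fin (k + r)) F}
    (hg : IsQuadraticDiagonal g) : IsQuadraticDiagonal (truncate k g) := by
  obtain ⟨c, e, hc, rfl⟩ := hg
  refine ⟨fun j => c (Fin.castAdd r j), e, fun j => hc _, ?_⟩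
  rw [truncate, map_sub, map_sum, Fin.sum_univ_add]
  simp

theorem eval_truncate {n k : ℕ} (f : MvPolynomial (Fin n) F) (x : Fin k → F) :
    MvPolynomial.eval x (truncate k f) =
      MvPolynomial.eval (fun i : Fin n => if h : (i : ℕ) < k then x ⟨i, h⟩ else 0) f := by
  induction f using MvPolynomial.induction_on with
  | C c => simp [truncate]
  | add p q hp hq => simp_all [truncate]
  | mul_X p i hp =>
    simp only [truncate, map_mul, MvPolynomial.aeval_X, MvPolynomial.eval_X] at hp ⊢
    rw [hp]
    split_ifs <;> simp

end Truncation
end FullyTriangular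

namespace FullyTriangular

/-! ### Quadratic character sums and diagonal torus counts. -/

section QuadraticCharSums

variable {F : Type*} [Field F] [Fintype F] [DecidableEq F]

theorem sum_comp_sq (hF : ringChar F ≠ 2) (w : F → ℤ) :
    ∑ y, w (y ^ 2) = ∑ u, (1 + quadraticChar F u) * w u := by
  rw [← Finset.sum_fiberwise Finset.univ (fun y : F => y ^ 2)]
  refine Finset.sum_congr rfl fun u _ => ?_
  rw [add_comm, ← quadraticChar_card_sqrts hF, Finset.sum_congr rfl (g := fun _ => w u),
    Finset.sum_const, nsmul_eq_mul]
  · congr 3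
    ext
    simp
  · intro y hy
    rw [(Finset.mem_filter.1 hy).2]

theorem sum_units_eq_sum_sub {R : Type*} [AddCommGroup R] (w : F → R) :
    ∑ u : Fˣ, w u = ∑ y, w y - w 0 := by
  rw [Fintype.sum_eq_add_sum_subtype_ne w 0, add_sub_cancel_left]
  exact Fintype.sum_equiv unitsEquivNeZero _ _ fun _ => rfl

theorem quadraticChar_mul_self {a : F} (ha : a ≠ 0) : quadraticChar F a * quadraticChar F a = 1 := by
  rw [← sq, quadraticChar_sq_one ha]

theorem quadraticChar_div (a b : F) :
    quadraticChar F (a / b) = quadraticChar F a * quadraticChar F b := by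
  by_cases hb : b = 0
  · simp [hb]
  · have h : quadraticChar F (a / b) * quadraticChar F b = quadraticChar F a := by
      rw [← map_mul, div_mul_cancel₀ _ hb]
    rw [← h, mul_assoc, quadraticChar_mul_self hb, mul_one]

theorem sum_units_indicator_sub_mul_sq (hF : ringChar F ≠ 2) {a : F} (ha : a ≠ 0) (b : F) :
    ∑ u : Fˣ, (if b - a * (u : F) ^ 2 = 0 then 1 else 0 : ℤ) =
      1 + quadraticChar F a * quadraticChar F b - if b = 0 then 1 else 0 := by
  rw [sum_units_eq_sum_sub (fun y : F => (if b - a * y ^ 2 = 0 then 1 else 0 : ℤ)),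
    sum_comp_sq hF (fun y : F => (if b - a * y = 0 then 1 else 0 : ℤ)),
    Finset.sum_eq_single (b / a)]
  · rw [quadraticChar_div, mul_div_cancel₀ _ ha, sub_self, if_pos rfl]
    simp [mul_comm]
  · intro u _ hu
    rw [if_neg, mul_zero]
    intro h
    exact hu ((eq_div_iff ha).2 (by linear_combination -h))
  · simp

/-- For `b ≠ 0`, substituting `u = (b / a) w` gives the Jacobi sum of `η` with its inverse, which is
`-η(-1)`. For `b = 0` every nonzero `u` contributes `η(-a)`. -/
theorem sum_quadraticChar_mul_sub (hF : ringChar F ≠ 2) {a : F} (ha : a ≠ 0) (b : F) :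
    ∑ u, quadraticChar F u * quadraticChar F (b - a * u) =
      quadraticChar F a * quadraticChar F (-1) * ((if b = 0 then (Fintype.card F : ℤ) else 0) - 1) := by
  by_cases hb : b = 0
  · subst hb
    have h : ∀ u, quadraticChar F u * quadraticChar F (0 - a * u) =
        quadraticChar F a * quadraticChar F (-1) * (1 - if u = 0 then 1 else 0) := by
      intro u
      by_cases hu : u = 0
      · simp [hu]
      · rw [show (0 : F) - a * u = a * (-1) * u by ring, map_mul, map_mul, if_neg hu]
        linear_combination (quadraticChar F a * quadraticChar F (-1)) * quadraticChar_mul_self hu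
    rw [Finset.sum_congr rfl fun u _ => h u, ← Finset.mul_sum, Finset.sum_sub_distrib]
    simp
  · have hba : b / a ≠ 0 := div_ne_zero hb ha
    rw [← Equiv.sum_comp (Equiv.mulLeft₀ (b / a) hba)]
    have h : ∀ w, quadraticChar F (Equiv.mulLeft₀ (b / a) hba w) *
        quadraticChar F (b - a * Equiv.mulLeft₀ (b / a) hba w) =
        quadraticChar F a * (quadraticChar F w * quadraticChar F (1 - w)) := by
      intro w
      rw [Equiv.mulLeft₀_apply, show b - a * (b / a * w) = b * (1 - w) by field_simp, map_mul, map_mul,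
        quadraticChar_div]
      linear_combination (quadraticChar F a * (quadraticChar F w * quadraticChar F (1 - w))) *
        quadraticChar_mul_self hb
    have hJ := jacobiSum_nontrivial_inv (quadraticChar_ne_one hF)
    rw [(quadraticChar_isQuadratic F).inv, jacobiSum] at hJ
    rw [Finset.sum_congr rfl fun u _ => h u, ← Finset.mul_sum, hJ, if_neg hb]
    ring

theorem sum_units_quadraticChar_sub_mul_sq (hF : ringChar F ≠ 2) {a : F} (ha : a ≠ 0) (b : F) :
    ∑ u : Fˣ, quadraticChar F (b - a * (u : F) ^ 2) =
      quadraticChar F a * quadraticChar F (-1) * ((if b = 0 then (Fintype.card F : ℤ) else 0) - 1)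
        - quadraticChar F b := by
  rw [sum_units_eq_sum_sub (fun y : F => quadraticChar F (b - a * y ^ 2)),
    sum_comp_sq hF (fun y : F => quadraticChar F (b - a * y))]
  simp only [add_mul, one_mul, Finset.sum_add_distrib, sum_quadraticChar_mul_sub hF ha b]
  have h : ∑ u, quadraticChar F (b - a * u) = 0 := by
    rw [← quadraticChar_sum_zero hF]
    exact ((Equiv.mulLeft₀ a ha).trans (Equiv.subLeft b)).sum_comp (quadraticChar F)
  rw [h]
  simp

/-- The number of points with nonzero coordinates on `∑ i, a i * x i ^ 2 = b`, when all `a i` have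
the same quadratic character `ε`. -/
theorem two_mul_card_mul_torus_diagonal (hF : ringChar F ≠ 2) {ε : ℤ} (hε : ε * ε = 1) {τ : ℂ}
    (hτ0 : τ ≠ 0) (hτ : τ ^ 2 = (Fintype.card F : ℂ) * ((quadraticChar F (-1) : ℤ) : ℂ))
    (k : ℕ) (a : Fin k → F) (ha : ∀ i, a i ≠ 0) (haε : ∀ i, quadraticChar F (a i) = ε) (b : F) :
    2 * (Fintype.card F : ℂ) *
        ∑ x : Fin k → Fˣ, (if ∑ i, a i * (x i : F) ^ 2 - b = 0 then 1 else 0 : ℂ) =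
      2 * ((Fintype.card F : ℂ) - 1) ^ k - ((τ - 1) ^ k + (-τ - 1) ^ k)
        + (if b = 0 then 1 else 0) * (Fintype.card F : ℂ) * ((τ - 1) ^ k + (-τ - 1) ^ k)
        + ε * ((quadraticChar F b : ℤ) : ℂ) * ((Fintype.card F : ℂ) / τ)
          * ((τ - 1) ^ k - (-τ - 1) ^ k) := by
  -- Fixing the first coordinate `u` replaces `b` by `b - a₀u²`. Summing over `u` keeps the span of
  -- `1`, `[b = 0]` and `η(b)` stable. With `P`, `M` the sum and difference of the two `k`-th
  -- powers, the step is `P ↦ τM - P`, `M ↦ τP - M`, whose eigenvalues are `±τ - 1`.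
  induction k generalizing b with
  | zero =>
    by_cases hb : b = 0 <;> simp [hb] <;> ring
  | succ k ih =>
    have ih' := fun c => ih (fun i => a i.succ) (fun i => ha _) (fun i => haε _) c
    rw [← (Fin.consEquiv fun _ => Fˣ).sum_comp, Fintype.sum_prod_type, Finset.mul_sum]
    have hstep : ∀ u : Fˣ, 2 * (Fintype.card F : ℂ) * ∑ x : Fin k → Fˣ,
        (if ∑ i, a i * ((Fin.consEquiv fun _ => Fˣ) (u, x) i : F) ^ 2 - b = 0 then 1 else 0 : ℂ) =
        2 * ((Fintype.card F : ℂ) - 1) ^ k - ((τ - 1) ^ k + (-τ - 1) ^ k)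
        + ((if b - a 0 * (u : F) ^ 2 = 0 then 1 else 0 : ℤ) : ℂ)
          * ((Fintype.card F : ℂ) * ((τ - 1) ^ k + (-τ - 1) ^ k))
        + ((quadraticChar F (b - a 0 * (u : F) ^ 2) : ℤ) : ℂ) * (ε * ((Fintype.card F : ℂ) / τ)
          * ((τ - 1) ^ k - (-τ - 1) ^ k)) := by
      intro u
      have h := ih' (b - a 0 * (u : F) ^ 2)
      have hx : ∀ x : Fin k → Fˣ, ∑ i, a i * ((Fin.consEquiv fun _ => Fˣ) (u, x) i : F) ^ 2 - b =
          ∑ i : Fin k, a i.succ * (x i : F) ^ 2 - (b - a 0 * (u : F) ^ 2) := by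
        intro x
        rw [Fin.sum_univ_succ]
        simp [Fin.consEquiv]
        ring
      simp only [hx, h]
      push_cast
      ring
    rw [Finset.sum_congr rfl fun u _ => hstep u, Finset.sum_add_distrib, Finset.sum_add_distrib,
      ← Finset.sum_mul, ← Finset.sum_mul, ← Int.cast_sum, ← Int.cast_sum,
      sum_units_indicator_sub_mul_sq hF (ha 0), sum_units_quadraticChar_sub_mul_sq hF (ha 0), haε 0,
      Finset.sum_const, Finset.card_univ, Fintype.card_units, nsmul_eq_mul,
      Nat.cast_sub Fintype.card_pos]
    have hε' : (ε : ℂ) * ε = 1 := by exact_mod_cast hε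
    -- Besides `ε² = 1`, the recursion needs only these two consequences of `τ² = q η(-1)`.
    have hr : (Fintype.card F : ℂ) / τ * τ = Fintype.card F := div_mul_cancel₀ _ hτ0
    have hr' : (Fintype.card F : ℂ) / τ * ((quadraticChar F (-1) : ℤ) : ℂ) = τ := by
      rw [div_mul_eq_mul_div, ← hτ, sq, mul_div_cancel_right₀ _ hτ0]
    simp only [pow_succ]
    push_cast
    generalize (((quadraticChar F) b : ℤ) : ℂ) = η
    generalize (((quadraticChar F) (-1) : ℤ) : ℂ) = η₁ at *
    generalize (Fintype.card F : ℂ) / τ = r at *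
    generalize (Fintype.card F : ℂ) = c at *
    generalize (τ - 1) ^ k = z at *
    generalize (-τ - 1) ^ k = z' at *
    generalize (ε : ℂ) = e at *
    by_cases hb : b = 0
    · simp only [if_pos hb]
      linear_combination (-(e * η * (z + z'))) * hr + (η₁ * r * (c - 1) * (z - z')) * hε'
        + (c - 1) * (z - z') * hr'
    · simp only [if_neg hb]
      linear_combination (-(e * η * (z + z'))) * hr + (η₁ * r * (-1) * (z - z')) * hε'
        + (-1) * (z - z') * hr'

end QuadraticCharSums
end FullyTriangular

/-! ### Sorting points by their first zero coordinate. -/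

namespace FullyTriangular

/-- Extension of a tuple of units by zeros. -/
def extendByZero {F : Type*} [Field F] {k : ℕ} (n : ℕ) (z : Fin k → Fˣ) (i : Fin n) : F :=
  if h : (i : ℕ) < k then z ⟨i, h⟩ else 0

theorem cons_extendByZero {F : Type*} [Field F] {k : ℕ} (n : ℕ) (u : Fˣ) (z : Fin k → Fˣ) :
    (Fin.cons (u : F) (extendByZero n z) : Fin (n + 1) → F) =
      extendByZero (n + 1) (Fin.cons u z : Fin (k + 1) → Fˣ) := by
  ext i
  refine Fin.cases ?_ (fun i => ?_) i
  · simp [extendByZero]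
  · simp only [Fin.cons_succ, extendByZero, Fin.val_succ, Nat.add_lt_add_iff_right]
    split_ifs with h
    · congr 1
    · rfl

/-- If `w x` depends only on the coordinates of `x` before its first zero, then a sum of `w` can be
computed by sorting the points by their first zero. -/
theorem sum_eq_sum_extendByZero {F : Type*} [Field F] [Fintype F] [DecidableEq F]
    {R : Type*} [CommSemiring R] (n : ℕ)
    (w : (Fin n → F) → R) (hw : ∀ i x y, x i = 0 → (∀ j ≤ i, x j = y j) → w x = w y) :
    ∑ x, w x = ∑ z : Fin n → Fˣ, w (extendByZero n z) +
      ∑ k ∈ Finset.range n, (Fintype.card F : R) ^ (n - 1 - k) *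
        ∑ z : Fin k → Fˣ, w (extendByZero n z) := by
  induction n with
  | zero =>
    simp only [Finset.range_zero, Finset.sum_empty, add_zero, Fintype.sum_unique]
    exact congrArg w (Subsingleton.elim _ _)
  | succ n ih =>
    have hsplit : ∀ v : F → R, ∑ y, v y = v 0 + ∑ u : Fˣ, v u := fun v => by
      rw [Fintype.sum_eq_add_sum_subtype_ne v 0]
      exact congrArg _ (Fintype.sum_equiv unitsEquivNeZero _ _ fun _ => rfl).symm
    have hcons : ∀ k, ∑ z : Fin (k + 1) → Fˣ, w (extendByZero (n + 1) z) =
        ∑ u : Fˣ, ∑ z : Fin k → Fˣ, w (Fin.cons (u : F) (extendByZero n z)) := by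
      intro k
      rw [← (Fin.consEquiv fun _ => Fˣ).sum_comp, Fintype.sum_prod_type]
      simp only [cons_extendByZero]
      rfl
    -- A zero in the first place makes the other `n` coordinates irrelevant: this is the summand `k
    -- = 0`, with weight `q^n`.
    have h0 : ∀ x : Fin n → F, w (Fin.cons 0 x) = w 0 := fun x =>
      hw 0 _ _ rfl fun j hj => by rw [Fin.le_zero_iff.1 hj]; rfl
    have hu : ∀ u : Fˣ, ∑ x : Fin n → F, w (Fin.cons (u : F) x) = _ := fun u =>
      ih (fun x => w (Fin.cons (u : F) x)) fun i x y hx hxy => hw i.succ _ _ (by simpa using hx)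
        fun j hj => by
          revert hj
          refine Fin.cases (by simp) (fun j hj => ?_) j
          simpa using hxy j (Fin.succ_le_succ_iff.1 hj)
    rw [← (Fin.consEquiv fun _ => F).sum_comp, Fintype.sum_prod_type, hsplit]
    change ∑ x : Fin n → F, w (Fin.cons 0 x) + ∑ u : Fˣ, ∑ x : Fin n → F, w (Fin.cons (u : F) x) = _
    simp only [h0, hu, Finset.sum_add_distrib]
    rw [Finset.sum_range_succ', hcons, add_comm (∑ k ∈ _, _) (_ * _), add_left_comm]
    congr 2
    · simp only [Finset.sum_const, Finset.card_univ, Fintype.card_pi, Finset.prod_const,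
        Fintype.card_fin, nsmul_eq_mul, Fintype.sum_unique]
      simp
      congr 2
    · rw [Finset.sum_comm]
      refine Finset.sum_congr rfl fun k hk => ?_
      rw [hcons, ← Finset.mul_sum, show n + 1 - 1 - (k + 1) = n - 1 - k by omega]

end FullyTriangular

/-! ### Root counts as weighted sums of torus counts. -/

namespace FullyTriangular

variable {F : Type*} [Field F]

theorem eval_triangularPoly_congr {n : ℕ} (a : Fin n → F) {d : Fin n → Fin n → ℕ}
    (hd : ∀ i j, i ≤ j → 0 < d i j) (b : F) {i : Fin n} {x y : Fin n → F} (hx : x i = 0)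
    (hxy : ∀ j ≤ i, x j = y j) :
    MvPolynomial.eval x (triangularPoly a d b) = MvPolynomial.eval y (triangularPoly a d b) := by
  simp only [triangularPoly, map_sub, map_sum, map_mul, map_prod, map_pow, MvPolynomial.eval_X,
    MvPolynomial.eval_C]
  congr 1
  refine Finset.sum_congr rfl fun j _ => congrArg _ ?_
  by_cases hij : i ≤ j
  · have hz : ∀ z : Fin n → F, z i = 0 → ∏ l ∈ Finset.Iic j, z l ^ d l j = 0 := fun z hz =>
      Finset.prod_eq_zero (Finset.mem_Iic.2 hij) (by rw [hz, zero_pow (hd i j hij).ne'])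
    rw [hz x hx, hz y (by rw [← hxy i le_rfl, hx])]
  · refine Finset.prod_congr rfl fun l hl => ?_
    rw [hxy l ((Finset.mem_Iic.1 hl).trans (not_le.1 hij).le)]

variable [Fintype F] [DecidableEq F]

theorem torusRoots_eq_sum {k : ℕ} (f : MvPolynomial (Fin k) F) :
    torusRoots f = ∑ x : Fin k → Fˣ, if MvPolynomial.eval (fun i => (x i : F)) f = 0 then 1 else 0 := by
  rw [torusRoots]
  congr!

theorem torusRoots_truncate {n k : ℕ} (f : MvPolynomial (Fin n) F) :
    torusRoots (truncate k f) =
      ∑ z : Fin k → Fˣ, if MvPolynomial.eval (extendByZero n z) f = 0 then 1 else 0 := by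
  simp only [torusRoots_eq_sum, eval_truncate]
  rfl

theorem numRoots_eq_sum {n : ℕ} (f : MvPolynomial (Fin n) F) :
    numRoots f = ∑ x, if MvPolynomial.eval x f = 0 then 1 else 0 := by
  rw [numRoots, Nat.card_eq_fintype_card, Fintype.card_subtype, Finset.card_filter]

theorem numRoots_triangularPoly {n : ℕ} (a : Fin n → F) {d : Fin n → Fin n → ℕ}
    (hd : ∀ i j, i ≤ j → 0 < d i j) (b : F) :
    numRoots (triangularPoly a d b) = torusRoots (truncate n (triangularPoly a d b)) +
      ∑ k ∈ Finset.range n, Fintype.card F ^ (n - 1 - k) *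
        torusRoots (truncate k (triangularPoly a d b)) := by
  simp only [torusRoots_truncate, numRoots_eq_sum]
  refine sum_eq_sum_extendByZero n
    (fun x => if MvPolynomial.eval x (triangularPoly a d b) = 0 then 1 else 0) fun i x y hx hxy => ?_
  rw [eval_triangularPoly_congr a hd b hx hxy]

omit [DecidableEq F] in
theorem torusRoots_truncate_triangularPoly {n : ℕ} {a : Fin n → F} (ha : ∀ j, a j ≠ 0)
    {d : Fin n → Fin n → ℕ} (hd : ∀ i j, i ≤ j → 0 < d i j) {b : F} {g : MvPolynomial (Fin n) F}
    (hg : IsQuadraticDiagonal g) (h : TotallyStarEquiv (triangularPoly a d b) g) {k : ℕ}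
    (hk : k ≤ n) :
    torusRoots (truncate k (triangularPoly a d b)) = torusRoots
      (∑ j : Fin k, MvPolynomial.C (a (Fin.castLE hk j)) * MvPolynomial.X j ^ 2 -
        MvPolynomial.C b) := by
  obtain ⟨r, rfl⟩ := Nat.exists_eq_add_of_le hk
  have ht := truncate_triangularPoly (k := k) (r := r) a hd b
  -- Total equivalence says nothing about `k = 0`, but there both sides are the constant `-b`.
  rcases Nat.eq_zero_or_pos k with rfl | hpos
  · rw [ht]
    simp [triangularPoly]
  · have hs := h k hpos hk
    rw [ht] at hs ⊢
    exact torusRoots_triangularPoly (fun j => ha _) (fun i j hij => hd _ _ hij)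
      (truncate_isQuadraticDiagonal hg) hs

/-! ### Evaluation of the geometric sums. -/

theorem sqrtQStar_sq (hF : ringChar F ≠ 2) :
    sqrtQStar (Fintype.card F) ^ 2 =
      (Fintype.card F : ℂ) * ((quadraticChar F (-1) : ℤ) : ℂ) := by
  have h : (Fintype.card F - 1) / 2 = Fintype.card F / 2 := by
    have := FiniteField.odd_card_of_char_ne_two hF
    omega
  rw [quadraticChar_neg_one hF, ZMod.χ₄_eq_neg_one_pow (FiniteField.odd_card_of_char_ne_two hF),
    sqrtQStar, one_div, Complex.cpow_ofNat_inv_pow, h]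
  push_cast
  rfl

theorem sub_mul_geom_weight {R : Type*} [CommRing R] (n : ℕ) (c z : R) :
    (z ^ n + ∑ k ∈ Finset.range n, c ^ (n - 1 - k) * z ^ k) * (z - c) =
      z ^ (n + 1) - (c - 1) * z ^ n - c ^ n := by
  rw [add_mul, Finset.sum_congr rfl fun k _ => mul_comm _ _, geom_sum₂_mul]
  ring

/-- The numerator of `geomTerm` has `ζ q^{n-1}` where the geometric sum has `q^n`; the difference is
`q^{n-1}(ζ - q)`. -/
theorem geom_weight_eq_geomTerm {q n : ℕ} (hn : 1 ≤ n) {z : ℂ} (hz : z - q ≠ 0) :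
    z ^ n + ∑ k ∈ Finset.range n, (q : ℂ) ^ (n - 1 - k) * z ^ k =
      geomTerm q n z + (q : ℂ) ^ (n - 1) := by
  obtain ⟨m, rfl⟩ := Nat.exists_eq_add_of_le' hn
  rw [geomTerm, div_add' _ _ _ hz, eq_div_iff hz, sub_mul_geom_weight, Nat.add_sub_cancel]
  ring

/-- The denominators `ζ_i - q` do not vanish: `τ = c + 1` would force `(c + 1)^4 = c^2`. -/
theorem sub_card_ne_zero {c : ℕ} (hc : 1 ≤ c) {τ s : ℂ} (hτ : τ ^ 2 = c * s) (hs : s ^ 2 = 1) :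
    τ - 1 - c ≠ 0 := by
  intro h
  have h1 : ((c : ℂ) + 1) ^ 2 = c * s := by
    rw [← hτ, ← sub_eq_zero.1 (by linear_combination h : τ - (c + 1) = 0)]
  have h2 : ((c : ℂ) + 1) ^ 4 = c ^ 2 := by
    linear_combination (((c : ℂ) + 1) ^ 2 + c * s) * h1 + (c : ℂ) ^ 2 * hs
  have h3 : (c + 1) ^ 4 = c ^ 2 := by exact_mod_cast h2
  nlinarith [Nat.zero_le (c ^ 2), Nat.zero_le (c ^ 3), Nat.zero_le (c ^ 4)]

theorem two_mul_card_mul_numRoots (hF : ringChar F ≠ 2) {n : ℕ} (hn : 1 ≤ n) {a : Fin n → F}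
    (ha : ∀ j, a j ≠ 0) {ε : ℤ} (hε : ε * ε = 1) (haε : ∀ j, quadraticChar F (a j) = ε)
    {d : Fin n → Fin n → ℕ} (hd : ∀ i j, i ≤ j → 0 < d i j) {b : F} {g : MvPolynomial (Fin n) F}
    (hg : IsQuadraticDiagonal g) (h : TotallyStarEquiv (triangularPoly a d b) g) (q : ℕ)
    (hq : q = Fintype.card F) :
    2 * (q : ℂ) * (numRoots (triangularPoly a d b) : ℂ) =
      2 * (q : ℂ) ^ n + ((if b = 0 then 1 else 0) * (q : ℂ) - 1) *
        (geomTerm q n (zeta₁ q) + geomTerm q n (zeta₂ q) + 2 * (q : ℂ) ^ (n - 1)) +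
      ε * ((quadraticChar F b : ℤ) : ℂ) * ((q : ℂ) / sqrtQStar q) *
        (geomTerm q n (zeta₁ q) - geomTerm q n (zeta₂ q)) := by
  subst hq
  have hs := quadraticChar_sq_one (F := F) (a := -1) (by simp)
  have hs' : (((quadraticChar F (-1) : ℤ) : ℂ)) ^ 2 = 1 := by exact_mod_cast hs
  have hτ := sqrtQStar_sq hF
  have hc : (Fintype.card F : ℂ) ≠ 0 := Nat.cast_ne_zero.2 Fintype.card_ne_zero
  have hτ0 : sqrtQStar (Fintype.card F) ≠ 0 := by
    intro h0
    rw [h0] at hτ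
    have := mul_ne_zero hc (pow_ne_zero_iff two_ne_zero |>.1 (hs'.symm ▸ one_ne_zero))
    exact this (by rw [← hτ]; simp)
  have hT : ∀ k ≤ n, 2 * (Fintype.card F : ℂ) *
      (torusRoots (truncate k (triangularPoly a d b)) : ℂ) =
      2 * ((Fintype.card F : ℂ) - 1) ^ k -
        ((sqrtQStar (Fintype.card F) - 1) ^ k + (-sqrtQStar (Fintype.card F) - 1) ^ k)
        + (if b = 0 then 1 else 0) * (Fintype.card F : ℂ) *
          ((sqrtQStar (Fintype.card F) - 1) ^ k + (-sqrtQStar (Fintype.card F) - 1) ^ k)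
        + ε * ((quadraticChar F b : ℤ) : ℂ) * ((Fintype.card F : ℂ) / sqrtQStar (Fintype.card F))
          * ((sqrtQStar (Fintype.card F) - 1) ^ k - (-sqrtQStar (Fintype.card F) - 1) ^ k) := by
    intro k hk
    rw [torusRoots_truncate_triangularPoly ha hd hg h hk, torusRoots_eq_sum]
    push_cast
    simp only [map_sub, map_sum, map_mul, map_pow, MvPolynomial.eval_X, MvPolynomial.eval_C]
    exact two_mul_card_mul_torus_diagonal hF hε hτ0 hτ k (fun j => a (Fin.castLE hk j))
      (fun j => ha _) (fun j => haε _) b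
  have h1 := geom_weight_eq_geomTerm hn (sub_card_ne_zero Fintype.card_pos hτ hs')
  have h2 := geom_weight_eq_geomTerm hn
    (sub_card_ne_zero (τ := -sqrtQStar (Fintype.card F)) Fintype.card_pos (by rw [neg_sq, hτ]) hs')
  -- At `z = q - 1` the factor `z - q` is `-1`, and the weighted sum collapses to `q^n`.
  have h3 := sub_mul_geom_weight n (Fintype.card F : ℂ) (Fintype.card F - 1)
  rw [zeta₁, zeta₂]
  set c : ℂ := (Fintype.card F : ℂ)
  set τ := sqrtQStar (Fintype.card F)
  have hsum : ∑ k ∈ Finset.range n, c ^ (n - 1 - k) *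
      (2 * c * (torusRoots (truncate k (triangularPoly a d b)) : ℂ)) =
      2 * ∑ k ∈ Finset.range n, c ^ (n - 1 - k) * (c - 1) ^ k +
      ((if b = 0 then 1 else 0) * c - 1) * (∑ k ∈ Finset.range n, c ^ (n - 1 - k) * (τ - 1) ^ k +
        ∑ k ∈ Finset.range n, c ^ (n - 1 - k) * (-τ - 1) ^ k) +
      ε * ((quadraticChar F b : ℤ) : ℂ) * (c / τ) *
        (∑ k ∈ Finset.range n, c ^ (n - 1 - k) * (τ - 1) ^ k -
        ∑ k ∈ Finset.range n, c ^ (n - 1 - k) * (-τ - 1) ^ k) := by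
    simp only [Finset.mul_sum, ← Finset.sum_add_distrib, ← Finset.sum_sub_distrib]
    refine Finset.sum_congr rfl fun k hk => ?_
    rw [hT k (Finset.mem_range.1 hk).le]
    ring
  have hn' := hT n le_rfl
  rw [numRoots_triangularPoly a hd b]
  push_cast
  rw [mul_add, hn', Finset.mul_sum, Finset.sum_congr rfl fun k _ => mul_left_comm _ _ _, hsum]
  linear_combination ((if b = 0 then 1 else 0) * c - 1) * (h1 + h2) +
    ε * ((quadraticChar F b : ℤ) : ℂ) * (c / τ) * (h1 - h2) - 2 * h3

end FullyTriangular

theorem corollary4p5 {F : Type*} [Field F] [Fintype F] [DecidableEq F]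
    (q : ℕ) (hq : q = Fintype.card F) (hodd : Odd q)
    (n : ℕ) (hn : 1 ≤ n)
    (f g : MvPolynomial (Fin n) F) (a : Fin n → F) (b : F)
    (hf : FullyTriangular.IsFullyTriangular f a b)
    (hg : FullyTriangular.IsQuadraticDiagonal g)
    (hfg : FullyTriangular.TotallyStarEquiv f g)
    (ε : ℤ)
    (hε : (ε = 1 ∧ ∀ j, IsSquare (a j)) ∨ (ε = -1 ∧ ∀ j, ¬ IsSquare (a j))) :
    (b ≠ 0 →
      (FullyTriangular.numRoots f : ℂ) =
        (q : ℂ) ^ ((n : ℤ) - 2) * ((q : ℂ) - 1)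
          - 1 / (2 * (q : ℂ)) *
            (FullyTriangular.geomTerm q n (FullyTriangular.zeta₁ q)
              + FullyTriangular.geomTerm q n (FullyTriangular.zeta₂ q))
          + (ε : ℂ) * ((quadraticChar F b : ℤ) : ℂ) / (2 * FullyTriangular.sqrtQStar q) *
            (FullyTriangular.geomTerm q n (FullyTriangular.zeta₁ q)
              - FullyTriangular.geomTerm q n (FullyTriangular.zeta₂ q))) ∧
    (b = 0 →
      (FullyTriangular.numRoots f : ℂ) =
        2 * (q : ℂ) ^ ((n : ℤ) - 1) - (q : ℂ) ^ ((n : ℤ) - 2)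
          + ((q : ℂ) - 1) / (2 * (q : ℂ)) *
            (FullyTriangular.geomTerm q n (FullyTriangular.zeta₁ q)
              + FullyTriangular.geomTerm q n (FullyTriangular.zeta₂ q))) := by
  obtain ⟨ha, d, hd, rfl⟩ := hf
  have hF : ringChar F ≠ 2 := fun h => by
    have := FiniteField.even_card_of_char_two h
    rw [hq] at hodd
    exact absurd (Nat.odd_iff.1 hodd) (by omega)
  have hε2 : ε * ε = 1 := by rcases hε with ⟨rfl, -⟩ | ⟨rfl, -⟩ <;> norm_num
  have haε : ∀ j, quadraticChar F (a j) = ε := by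
    rcases hε with ⟨rfl, h⟩ | ⟨rfl, h⟩
    · exact fun j => (quadraticChar_one_iff_isSquare (ha j)).2 (h j)
    · exact fun j => quadraticChar_neg_one_iff_not_isSquare.2 (h j)
  have key := FullyTriangular.two_mul_card_mul_numRoots hF hn ha hε2 haε hd hg hfg q hq
  have hq0 : (q : ℂ) ≠ 0 := by rw [hq]; exact Nat.cast_ne_zero.2 Fintype.card_ne_zero
  obtain ⟨m, rfl⟩ := Nat.exists_eq_add_of_le' hn
  rw [Nat.add_sub_cancel] at key
  -- Integer powers are needed since `n - 2 = -1` when `n = 1`.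
  have hz1 : (q : ℂ) ^ (((m + 1 : ℕ) : ℤ) - 1) = (q : ℂ) ^ m := by
    rw [← zpow_natCast]; congr 1; push_cast; ring
  have hz2 : (q : ℂ) ^ (((m + 1 : ℕ) : ℤ) - 2) = (q : ℂ) ^ m / q := by
    rw [← zpow_natCast, div_eq_mul_inv, ← zpow_sub_one₀ hq0]; congr 1; push_cast; ring
  rw [hz1, hz2]
  refine ⟨fun hb => ?_, fun hb => ?_⟩ <;>
    refine mul_left_cancel₀ (mul_ne_zero two_ne_zero hq0) (key.trans ?_)
  · rw [if_neg hb]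
    generalize (quadraticChar F b : ℤ) = η
    generalize FullyTriangular.geomTerm q (m + 1) (FullyTriangular.zeta₁ q) = S₁
    generalize FullyTriangular.geomTerm q (m + 1) (FullyTriangular.zeta₂ q) = S₂
    field_simp
    ring
  · subst hb
    rw [if_pos rfl, quadraticChar_zero]
    field_simp
    push_cast
    ring
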